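/- Let $\mathbb{D}=\{z\in\mathbb{C}:|z|<1\}$. An Orlicz function is a strictly convex function $\psi:[0,\infty)\to[0,\infty)$ with $\psi(0)=0$, continuous at $0$, such that $\psi(x)/x\to+\infty$ as $x\to+\infty$. It satisfies the $\Delta^2$-condition if there are $C>0$ and $x_0>0$ such that $\psi(x)^2\le\psi(Cx)$ for every $x\ge x_0$. For $\alpha>-1$, let $dv_\alpha(z)=\frac{\alpha+1}{\pi}(1-|z|^2)^\alpha\,dA(z)$ be the normalized weighted Lebesgue measure on $\mathbb{D}$ ($dA$ is planar Lebesgue measure). The weighted Bergman-Orlicz space $A^\psi_\alpha(\mathbb{D})$ is the space of holomorphic functions $f:\mathbb{D}\to\mathbb{C}$ such that $\int_{\mathbb{D}}\psi(|f|/C)\,dv_\alpha<\infty$ for some $C>0$, with the Luxemburg norm $\|f\|=\inf\{C>0:\int_{\mathbb{D}}\psi(|f|/C)\,dv_\alpha\le1\}$. For $|\zeta|=1$ and $b>1$, let $$\Gamma(\zeta,b)=\left\{z\in\mathbb{D}:|1-z\overline{\zeta}|<\tfrac{b}{2}(1-|z|^2)\right\}.$$ Proposition 3.10. Let $\alpha>-1$,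 let $b>1$ and let $\psi$ be an Orlicz function satisfying the $\Delta^2$-condition. Then there exist a point $\zeta$ with $|\zeta|=1$ and a holomorphic map $\phi:\mathbb{D}\to\mathbb{D}$ with $\phi(\mathbb{D})\subset\Gamma(\zeta,b)$ such that the composition operator $C_\phi f=f\circ\phi$ is a well-defined bounded operator on $A^\psi_\alpha(\mathbb{D})$ but is not compact. -/

import Mathlib

open MeasureTheory Filter Topology Set
open scoped ENNReal

/-- The open unit disc `𝔻` of the complex plane, as a type. -/
abbrev Disc : Type := Metric.ball (0 : ℂ) 1

/-- Planar Lebesgue measure on the disc. -/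
noncomputable def discMeasure : Measure Disc := (volume : Measure ℂ).comap (fun z : Disc => (z : ℂ))

/-- A complex-valued function on the disc is holomorphic: it is the restriction to the disc of a
function on the plane that is complex differentiable at every point of the disc. -/
def IsHolo (f : Disc → ℂ) : Prop :=
  ∃ F : ℂ → ℂ, DifferentiableOn ℂ F (Metric.ball (0 : ℂ) 1) ∧ ∀ z : Disc, f z = F z

/-- Orlicz functions: strictly convex functions `ψ : [0, ∞) → [0, ∞)` with `ψ 0 = 0`, continuous
at `0`, such that `ψ x / x → ∞` as `x → ∞`. (The values on the negative half-line are irrelevant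
and are never used.) -/
structure OrliczFunction where
  toFun : ℝ → ℝ
  nonneg' : ∀ x, 0 ≤ x → 0 ≤ toFun x
  strictConvexOn' : StrictConvexOn ℝ (Ici 0) toFun
  map_zero' : toFun 0 = 0
  continuous_zero' : ContinuousWithinAt toFun (Ici 0) 0
  tendsto_div' : Tendsto (fun x => toFun x / x) atTop atTop

namespace OrliczFunction

instance : CoeFun OrliczFunction (fun _ => ℝ → ℝ) := ⟨OrliczFunction.toFun⟩

/-- The condition `Δ²` of fast growth: `ψ(x)² ≤ ψ(C x)` for all large `x`, for some `C > 0`. -/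
def DeltaSup2 (ψ : OrliczFunction) : Prop :=
  ∃ C > (0 : ℝ), ∃ x₀ > (0 : ℝ), ∀ x, x₀ ≤ x → ψ x ^ 2 ≤ ψ (C * x)

variable (ψ : OrliczFunction)

theorem convex_le {s t x y : ℝ} (hs : 0 ≤ s) (ht : 0 ≤ t) (hst : s + t = 1) (hx : 0 ≤ x)
    (hy : 0 ≤ y) : ψ (s * x + t * y) ≤ s * ψ x + t * ψ y := by
  simpa using ψ.strictConvexOn'.convexOn.2 hx hy hs ht hst

theorem map_mul_le {s x : ℝ} (hs : 0 ≤ s) (hs1 : s ≤ 1) (hx : 0 ≤ x) : ψ (s * x) ≤ s * ψ x := by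
  have := ψ.convex_le hs (sub_nonneg.2 hs1) (by ring) hx le_rfl
  simpa [ψ.map_zero'] using this

theorem mono {x y : ℝ} (hx : 0 ≤ x) (hxy : x ≤ y) : ψ x ≤ ψ y := by
  rcases hx.eq_or_lt with rfl | hx'
  · rw [ψ.map_zero']; exact ψ.nonneg' y hxy
  have hy : 0 < y := hx'.trans_le hxy
  have h1 : x / y ≤ 1 := (div_le_one hy).2 hxy
  have h := ψ.map_mul_le (div_nonneg hx hy.le) h1 hy.le
  rw [div_mul_cancel₀ _ hy.ne'] at h
  exact h.trans (mul_le_of_le_one_left (ψ.nonneg' y hy.le) h1)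

theorem pos {x : ℝ} (hx : 0 < x) : 0 < ψ x := by
  have h := ψ.strictConvexOn'.2 (mem_Ici.2 hx.le) (mem_Ici.2 le_rfl) hx.ne'
    (by norm_num : (0 : ℝ) < 1 / 2) (by norm_num : (0 : ℝ) < 1 / 2) (by norm_num)
  have h2 := ψ.nonneg' ((1 / 2 : ℝ) * x) (by positivity)
  simp only [smul_eq_mul, mul_zero, add_zero, ψ.map_zero'] at h
  linarith

theorem measurable_comp_norm {f : Disc → ℂ} (hf : Continuous f) (C : ℝ) (hC : 0 < C) :
    Measurable fun z => ENNReal.ofReal (ψ (‖f z‖ / C)) := by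
  have hm : Monotone fun x : ℝ => ψ (max x 0) := fun x y h =>
    ψ.mono (le_max_right _ _) (max_le_max_right _ h)
  have h1 : Measurable fun z => ‖f z‖ / C := (hf.norm.div_const C).measurable
  have h2 := (hm.measurable.comp h1).ennreal_ofReal
  have : (fun z => ENNReal.ofReal (ψ (‖f z‖ / C)))
      = fun z => ENNReal.ofReal (((fun x : ℝ => ψ (max x 0)) ∘ fun z => ‖f z‖ / C) z) := by
    funext z
    have : 0 ≤ ‖f z‖ / C := by positivity
    simp [max_eq_left this]
  rw [this]; exact h2

end OrliczFunction

namespace IsHolo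

theorem continuous {f : Disc → ℂ} (hf : IsHolo f) : Continuous f := by
  obtain ⟨F, hF, hfF⟩ := hf
  have : f = (Metric.ball (0 : ℂ) 1).domRestrict F := funext hfF
  rw [this]; exact hF.continuousOn.domRestrict

theorem zero : IsHolo 0 := ⟨0, differentiableOn_const 0, fun _ => rfl⟩

theorem add {f g : Disc → ℂ} (hf : IsHolo f) (hg : IsHolo g) : IsHolo (f + g) := by
  obtain ⟨F, hF, hfF⟩ := hf
  obtain ⟨G, hG, hgG⟩ := hg
  exact ⟨F + G, hF.add hG, fun z => by simp [hfF, hgG]⟩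

theorem smul {f : Disc → ℂ} (hf : IsHolo f) (c : ℂ) : IsHolo (c • f) := by
  obtain ⟨F, hF, hfF⟩ := hf
  exact ⟨c • F, hF.const_smul c, fun z => by simp [hfF]⟩

end IsHolo

/-- The normalized weighted Lebesgue measure `dv_α = c_α (1 - |z|²)^α dv` on the disc; with respect
to planar Lebesgue measure the normalizing constant is `(α + 1) / π`. -/
noncomputable def weightedMeasure (α : ℝ) : Measure Disc :=
  discMeasure.withDensity
    fun z => ENNReal.ofReal ((α + 1) / Real.pi * (1 - ‖(z : ℂ)‖ ^ 2) ^ α)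

theorem radial_integral {α : ℝ} (hα : -1 < α) :
    ∫⁻ r in Ioo (0 : ℝ) 1, ENNReal.ofReal (2 * (α + 1) * r * (1 - r ^ 2) ^ α) = 1 := by
  have h0 : 0 < α + 1 := by linarith
  set g : ℝ → ℝ := fun r => -(1 - r ^ 2) ^ (α + 1) with hg
  have hcont : ContinuousOn g (Icc 0 1) :=
    (ContinuousOn.rpow_const (by fun_prop) fun x _ => Or.inr h0.le).neg
  have hderiv : ∀ r ∈ Ioo (0 : ℝ) 1, HasDerivAt g (2 * (α + 1) * r * (1 - r ^ 2) ^ α) r := by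
    intro r hr
    have h1 : 0 < 1 - r ^ 2 := by nlinarith [hr.1, hr.2]
    have h2 : HasDerivAt (fun r : ℝ => 1 - r ^ 2) (-(2 * r)) r := by
      simpa using (hasDerivAt_pow 2 r).const_sub 1
    have h3 := (h2.rpow_const (p := α + 1) (Or.inl h1.ne')).neg
    refine h3.congr_deriv ?_
    rw [add_sub_cancel_right]; ring
  have hpos : ∀ r ∈ Ioo (0 : ℝ) 1, 0 ≤ 2 * (α + 1) * r * (1 - r ^ 2) ^ α := by
    intro r hr
    have h1 : 0 < 1 - r ^ 2 := by nlinarith [hr.1, hr.2]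
    have := hr.1
    positivity
  have hint := intervalIntegral.integrableOn_deriv_of_nonneg hcont hderiv hpos
  have hint' : IntegrableOn (fun r : ℝ => 2 * (α + 1) * r * (1 - r ^ 2) ^ α) (Ioo 0 1) :=
    hint.mono_set Ioo_subset_Ioc_self
  have hval := intervalIntegral.integral_eq_sub_of_hasDerivAt_of_le zero_le_one hcont hderiv
    ((intervalIntegrable_iff_integrableOn_Ioc_of_le zero_le_one).2 hint)
  rw [intervalIntegral.integral_of_le zero_le_one, integral_Ioc_eq_integral_Ioo] at hval
  rw [← ofReal_integral_eq_lintegral_ofReal hint'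
    ((ae_restrict_iff' measurableSet_Ioo).2 (Eventually.of_forall hpos)), hval]
  simp [hg, Real.zero_rpow h0.ne']

/-- The measure `v_α` is normalized. -/
theorem weightedMeasure_univ {α : ℝ} (hα : -1 < α) : weightedMeasure α univ = 1 := by
  have h0 : 0 < α + 1 := by linarith
  set w : ℝ → ℝ≥0∞ := (Iio (1 : ℝ)).indicator
    fun r => ENNReal.ofReal ((α + 1) / Real.pi * (1 - r ^ 2) ^ α) with hw
  have hwm : Measurable w := by
    refine Measurable.indicator ?_ measurableSet_Iio
    fun_prop
  have h1 : weightedMeasure α univ = ∫⁻ z : ℂ, w ‖z‖ := by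
    rw [weightedMeasure, withDensity_apply _ MeasurableSet.univ, Measure.restrict_univ, discMeasure,
      lintegral_subtype_comap measurableSet_ball
        (fun z : ℂ => ENNReal.ofReal ((α + 1) / Real.pi * (1 - ‖z‖ ^ 2) ^ α)),
      ← lintegral_indicator measurableSet_ball]
    refine lintegral_congr fun z => ?_
    simp [hw, indicator]
  have hm2 : Measurable fun r : ℝ => ENNReal.ofReal r * w |r| :=
    ENNReal.measurable_ofReal.mul (hwm.comp measurable_norm)
  have h2 : ∫⁻ r in Ioi (0 : ℝ), ENNReal.ofReal r * w |r|
      = ENNReal.ofReal (1 / (2 * Real.pi)) := by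
    rw [← mul_one (ENNReal.ofReal _), ← radial_integral hα,
      ← lintegral_const_mul' _ _ ENNReal.ofReal_ne_top, ← lintegral_indicator measurableSet_Ioi,
      ← lintegral_indicator measurableSet_Ioo]
    refine lintegral_congr fun r => ?_
    by_cases hr : 0 < r
    · by_cases hr1 : r < 1
      · have h3 : 0 < 1 - r ^ 2 := by nlinarith
        simp only [indicator, mem_Ioi, mem_Ioo, mem_Iio, hr, hr1, and_self, if_true, hw,
          abs_of_pos hr]
        rw [← ENNReal.ofReal_mul hr.le, ← ENNReal.ofReal_mul (by positivity)]
        congr 1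
        field_simp
      · simp [indicator, hr, hr1, hw, abs_of_pos hr]
    · simp [indicator, hr]
  rw [h1, ← Complex.lintegral_comp_polarCoord_symm]
  simp only [Complex.norm_polarCoord_symm, polarCoord_target, smul_eq_mul]
  rw [Measure.volume_eq_prod, ← Measure.prod_restrict,
    lintegral_prod (fun p : ℝ × ℝ => ENNReal.ofReal p.1 * w |p.1|)
      (hm2.comp measurable_fst).aemeasurable]
  simp only [lintegral_const, Measure.restrict_apply_univ, Real.volume_Ioo]
  rw [lintegral_mul_const _ hm2, h2, ← ENNReal.ofReal_mul (by positivity), ← ENNReal.ofReal_one]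
  congr 1
  field_simp
  ring

/-- The integral `∫ ψ(|f| / C) dv_α`, with values in `[0, ∞]`. -/
noncomputable def modular (ψ : OrliczFunction) (α : ℝ) (f : Disc → ℂ) (C : ℝ) : ℝ≥0∞ :=
  ∫⁻ z, ENNReal.ofReal (ψ (‖f z‖ / C)) ∂(weightedMeasure α)

/-- The Luxemburg norm `inf {C > 0 : ∫ ψ(|f| / C) dv_α ≤ 1}`. -/
noncomputable def luxemburgNorm (ψ : OrliczFunction) (α : ℝ) (f : Disc → ℂ) : ℝ :=
  sInf {C : ℝ | 0 < C ∧ modular ψ α f C ≤ 1}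

section modular

theorem modular_zero (ψ : OrliczFunction) (α C : ℝ) : modular ψ α 0 C = 0 := by
  simp [modular, ψ.map_zero']

theorem modular_smul (ψ : OrliczFunction) (α : ℝ) (f : Disc → ℂ) {c : ℂ} (hc : c ≠ 0) (C : ℝ) :
    modular ψ α (c • f) (‖c‖ * C) = modular ψ α f C := by
  have : ‖c‖ ≠ 0 := by simpa using hc
  simp only [modular, Pi.smul_apply, norm_smul, mul_div_mul_left _ _ this]

theorem modular_add (ψ : OrliczFunction) (α : ℝ) {f g : Disc → ℂ} (hf : Continuous f)
    {C D : ℝ} (hC : 0 < C) (hD : 0 < D) :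
    modular ψ α (f + g) (C + D) ≤
      ENNReal.ofReal (C / (C + D)) * modular ψ α f C
        + ENNReal.ofReal (D / (C + D)) * modular ψ α g D := by
  have hCD : 0 < C + D := add_pos hC hD
  unfold modular
  rw [← lintegral_const_mul' _ _ ENNReal.ofReal_ne_top,
    ← lintegral_const_mul' _ _ ENNReal.ofReal_ne_top,
    ← lintegral_add_left ((ψ.measurable_comp_norm hf C hC).const_mul _)]
  refine lintegral_mono fun z => ?_
  have h0 : 0 ≤ C / (C + D) := by positivity
  have h1 : 0 ≤ D / (C + D) := by positivity
  have hx : 0 ≤ ‖f z‖ / C := by positivity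
  have hy : 0 ≤ ‖g z‖ / D := by positivity
  have key : ψ (‖(f + g) z‖ / (C + D))
      ≤ C / (C + D) * ψ (‖f z‖ / C) + D / (C + D) * ψ (‖g z‖ / D) := by
    refine le_trans (ψ.mono (by positivity) ?_)
      (ψ.convex_le h0 h1 (by field_simp) hx hy)
    have : C / (C + D) * (‖f z‖ / C) + D / (C + D) * (‖g z‖ / D)
        = (‖f z‖ + ‖g z‖) / (C + D) := by field_simp
    rw [this]
    exact div_le_div_of_nonneg_right (norm_add_le _ _) hCD.le
  calc ENNReal.ofReal (ψ (‖(f + g) z‖ / (C + D)))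
      ≤ ENNReal.ofReal (C / (C + D) * ψ (‖f z‖ / C) + D / (C + D) * ψ (‖g z‖ / D)) :=
        ENNReal.ofReal_le_ofReal key
    _ = _ := by
        rw [ENNReal.ofReal_add (mul_nonneg h0 (ψ.nonneg' _ hx)) (mul_nonneg h1 (ψ.nonneg' _ hy)),
          ENNReal.ofReal_mul h0, ENNReal.ofReal_mul h1]

theorem modular_mul_le (ψ : OrliczFunction) (α : ℝ) (f : Disc → ℂ) {K C : ℝ} (hK : 1 ≤ K)
    (hC : 0 < C) : modular ψ α f (K * C) ≤ ENNReal.ofReal (1 / K) * modular ψ α f C := by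
  have hK0 : 0 < K := by linarith
  unfold modular
  rw [← lintegral_const_mul' _ _ ENNReal.ofReal_ne_top]
  refine lintegral_mono fun z => ?_
  rw [← ENNReal.ofReal_mul (by positivity)]
  refine ENNReal.ofReal_le_ofReal ?_
  have h := ψ.map_mul_le (s := 1 / K) (x := ‖f z‖ / C) (by positivity)
    ((div_le_one hK0).2 hK) (by positivity)
  rwa [show 1 / K * (‖f z‖ / C) = ‖f z‖ / (K * C) by field_simp] at h

end modular

/-- The holomorphic functions in the Orlicz space `L^ψ(𝔻, v_α)`. -/
def bergmanOrliczSubmodule (ψ : OrliczFunction) (α : ℝ) : Submodule ℂ (Disc → ℂ) where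
  carrier := {f | IsHolo f ∧ ∃ C > (0 : ℝ), modular ψ α f C < ∞}
  zero_mem' := ⟨IsHolo.zero, 1, one_pos, by simp [modular_zero]⟩
  add_mem' := by
    rintro f g ⟨hf, C, hC, hfC⟩ ⟨hg, D, hD, hgD⟩
    refine ⟨hf.add hg, C + D, add_pos hC hD, (modular_add ψ α hf.continuous hC hD).trans_lt ?_⟩
    exact ENNReal.add_lt_top.2 ⟨ENNReal.mul_lt_top ENNReal.ofReal_lt_top hfC,
      ENNReal.mul_lt_top ENNReal.ofReal_lt_top hgD⟩
  smul_mem' := by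
    rintro c f ⟨hf, C, hC, hfC⟩
    refine ⟨hf.smul c, ?_⟩
    rcases eq_or_ne c 0 with rfl | hc
    · exact ⟨1, one_pos, by simp [modular_zero]⟩
    · exact ⟨‖c‖ * C, by positivity, by rwa [modular_smul ψ α f hc]⟩

/-- The weighted Bergman-Orlicz space `A_α^ψ(𝔻) = L^ψ(𝔻, v_α) ∩ H(𝔻)`, for `α > -1`, which is
normed by the Luxemburg norm below. -/
def BergmanOrlicz (ψ : OrliczFunction) {α : ℝ} (_hα : -1 < α) : Type :=
  bergmanOrliczSubmodule ψ α

namespace BergmanOrlicz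

variable {ψ : OrliczFunction} {α : ℝ} {hα : -1 < α}

noncomputable instance : AddCommGroup (BergmanOrlicz ψ hα) :=
  inferInstanceAs (AddCommGroup (bergmanOrliczSubmodule ψ α))

noncomputable instance : Module ℂ (BergmanOrlicz ψ hα) :=
  inferInstanceAs (Module ℂ (bergmanOrliczSubmodule ψ α))

instance : CoeFun (BergmanOrlicz ψ hα) (fun _ => Disc → ℂ) :=
  ⟨fun f => Subtype.val (p := fun f => f ∈ bergmanOrliczSubmodule ψ α) f⟩

noncomputable instance : Norm (BergmanOrlicz ψ hα) := ⟨fun f => luxemburgNorm ψ α f⟩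

theorem norm_def (f : BergmanOrlicz ψ hα) : ‖f‖ = luxemburgNorm ψ α f := rfl

theorem coe_zero : ((0 : BergmanOrlicz ψ hα) : Disc → ℂ) = 0 := rfl

theorem coe_add (f g : BergmanOrlicz ψ hα) : (f + g : BergmanOrlicz ψ hα) = (f + g : Disc → ℂ) :=
  rfl

theorem coe_smul (c : ℂ) (f : BergmanOrlicz ψ hα) :
    (c • f : BergmanOrlicz ψ hα) = (c • f : Disc → ℂ) := rfl

theorem isHolo (f : BergmanOrlicz ψ hα) : IsHolo f := f.2.1

theorem ext {f g : BergmanOrlicz ψ hα} (h : ∀ z, f z = g z) : f = g := Subtype.ext (funext h)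

theorem bddBelow (f : Disc → ℂ) : BddBelow {C : ℝ | 0 < C ∧ modular ψ α f C ≤ 1} :=
  ⟨0, fun _ h => h.1.le⟩

theorem nonempty (f : BergmanOrlicz ψ hα) : {C : ℝ | 0 < C ∧ modular ψ α f C ≤ 1}.Nonempty := by
  obtain ⟨-, C, hC, hfC⟩ := f.2
  set K : ℝ := max 1 (modular ψ α f C).toReal with hK
  have hK1 : 1 ≤ K := le_max_left _ _
  have hK0 : 0 < K := by linarith
  refine ⟨K * C, by positivity, (modular_mul_le ψ α f hK1 hC).trans ?_⟩
  rw [← ENNReal.ofReal_toReal hfC.ne, ← ENNReal.ofReal_mul (by positivity), ← ENNReal.ofReal_one]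
  refine ENNReal.ofReal_le_ofReal ?_
  rw [div_mul_eq_mul_div, one_mul, div_le_one hK0]
  exact le_max_right _ _

theorem norm_nonneg' (f : BergmanOrlicz ψ hα) : 0 ≤ ‖f‖ :=
  Real.sInf_nonneg fun _ h => h.1.le

theorem norm_le {f : BergmanOrlicz ψ hα} {C : ℝ} (hC : 0 < C) (h : modular ψ α f C ≤ 1) :
    ‖f‖ ≤ C := csInf_le (bddBelow _) ⟨hC, h⟩

theorem exists_of_norm_lt {f : BergmanOrlicz ψ hα} {r : ℝ} (h : ‖f‖ < r) :
    ∃ C, 0 < C ∧ C < r ∧ modular ψ α f C ≤ 1 := by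
  obtain ⟨C, ⟨h1, h2⟩, h3⟩ := exists_lt_of_csInf_lt f.nonempty h
  exact ⟨C, h1, h3, h2⟩

theorem norm_add_le' (f g : BergmanOrlicz ψ hα) : ‖f + g‖ ≤ ‖f‖ + ‖g‖ := by
  refine le_of_forall_pos_lt_add fun ε hε => ?_
  obtain ⟨C, hC, hCf, h1⟩ := exists_of_norm_lt (f := f) (r := ‖f‖ + ε / 2) (by linarith)
  obtain ⟨D, hD, hDg, h2⟩ := exists_of_norm_lt (f := g) (r := ‖g‖ + ε / 2) (by linarith)
  have hCD : 0 < C + D := add_pos hC hD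
  have : modular ψ α (f + g : BergmanOrlicz ψ hα) (C + D) ≤ 1 := by
    refine (modular_add ψ α f.isHolo.continuous hC hD).trans ?_
    calc _ ≤ ENNReal.ofReal (C / (C + D)) * 1 + ENNReal.ofReal (D / (C + D)) * 1 := by gcongr
      _ = 1 := by
        rw [mul_one, mul_one, ← ENNReal.ofReal_add (by positivity) (by positivity), ← add_div,
          div_self hCD.ne', ENNReal.ofReal_one]
  have := norm_le hCD this
  linarith

theorem norm_zero' : ‖(0 : BergmanOrlicz ψ hα)‖ = 0 := by
  refine le_antisymm (le_of_forall_pos_le_add fun ε hε => ?_) (norm_nonneg' _)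
  rw [zero_add]
  exact norm_le hε (by rw [coe_zero, modular_zero]; exact zero_le_one)

theorem norm_smul_le' (c : ℂ) (f : BergmanOrlicz ψ hα) : ‖c • f‖ ≤ ‖c‖ * ‖f‖ := by
  rcases eq_or_ne c 0 with rfl | hc
  · simp [norm_zero']
  have hc' : 0 < ‖c‖ := by simpa using hc
  rw [← div_le_iff₀' hc']
  refine le_csInf f.nonempty fun C hC => ?_
  rw [div_le_iff₀' hc']
  refine norm_le (mul_pos hc' hC.1) ?_
  rw [coe_smul, modular_smul ψ α f hc]
  exact hC.2

theorem norm_smul' (c : ℂ) (f : BergmanOrlicz ψ hα) : ‖c • f‖ = ‖c‖ * ‖f‖ := by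
  refine le_antisymm (norm_smul_le' c f) ?_
  rcases eq_or_ne c 0 with rfl | hc
  · simpa using norm_nonneg' _
  have hc' : 0 < ‖c‖ := by simpa using hc
  have h := norm_smul_le' c⁻¹ (c • f)
  rw [smul_smul, inv_mul_cancel₀ hc, one_smul, norm_inv] at h
  rwa [inv_mul_eq_div, le_div_iff₀' hc'] at h

theorem eq_zero_of_norm (f : BergmanOrlicz ψ hα) (h : ‖f‖ = 0) : f = 0 := by
  have h0 : modular ψ α f 1 = 0 := by
    refine le_antisymm (ENNReal.le_of_forall_pos_le_add fun ε hε _ => ?_) zero_le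
    have hr : 0 < min (ε : ℝ) 1 := lt_min (by exact_mod_cast hε) one_pos
    obtain ⟨C, hC, hCr, h1⟩ := exists_of_norm_lt (f := f) (r := min (ε : ℝ) 1) (by rw [h]; exact hr)
    have hC1 : C ≤ 1 := hCr.le.trans (min_le_right _ _)
    have h2 := modular_mul_le ψ α f (K := 1 / C) ((one_le_div hC).2 hC1) hC
    rw [one_div_mul_cancel hC.ne', one_div_one_div] at h2
    rw [zero_add]
    refine h2.trans ((mul_le_of_le_one_right zero_le h1).trans ?_)
    exact ENNReal.ofReal_le_of_le_toReal (by simpa using hCr.le.trans (min_le_left _ _))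
  have hm := ψ.measurable_comp_norm f.isHolo.continuous 1 one_pos
  have hw : Measurable fun z : Disc =>
      ENNReal.ofReal ((α + 1) / Real.pi * (1 - ‖(z : ℂ)‖ ^ 2) ^ α) := by fun_prop
  have hae := (lintegral_eq_zero_iff hm).1 h0
  unfold weightedMeasure at hae
  rw [Filter.EventuallyEq, ae_withDensity_iff hw] at hae
  have hae' : (f : Disc → ℂ) =ᵐ[discMeasure] (fun _ => 0) := by
    filter_upwards [hae] with z hz
    have hz1 : ‖(z : ℂ)‖ < 1 := mem_ball_zero_iff.1 z.2
    have hpos : 0 < (α + 1) / Real.pi * (1 - ‖(z : ℂ)‖ ^ 2) ^ α := by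
      have h1 : 0 < 1 - ‖(z : ℂ)‖ ^ 2 := by nlinarith [norm_nonneg (z : ℂ)]
      have h2 := Real.rpow_pos_of_pos h1 α
      have h3 : 0 < α + 1 := by linarith
      have := Real.pi_pos
      positivity
    have := hz (by simpa using hpos)
    by_contra hne
    have h2 : 0 < ‖f z‖ / 1 := by simpa using hne
    have := ψ.pos h2
    simp_all
    linarith
  have : discMeasure.IsOpenPosMeasure :=
    Measure.IsOpenPosMeasure.comap (μ := (volume : Measure ℂ))
      (Metric.isOpen_ball.isOpenEmbedding_subtypeVal)
  have h3 := Measure.eq_of_ae_eq hae' f.isHolo.continuous continuous_const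
  exact ext fun z => congrFun h3 z

theorem core : NormedSpace.Core ℂ (BergmanOrlicz ψ hα) where
  norm_nonneg := norm_nonneg'
  norm_smul := norm_smul'
  norm_triangle := norm_add_le'
  norm_eq_zero_iff f := ⟨eq_zero_of_norm f, fun h => by rw [h, norm_zero']⟩

noncomputable instance : NormedAddCommGroup (BergmanOrlicz ψ hα) := NormedAddCommGroup.ofCore core

noncomputable instance : NormedSpace ℂ (BergmanOrlicz ψ hα) := NormedSpace.ofCore core

end BergmanOrlicz

/-- The non-tangential approach region `Γ(ζ, b) = {z ∈ 𝔻 : |1 - z ζ̄| < (b / 2) (1 - |z|²)}`. -/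
def approachRegion (ζ : ℂ) (b : ℝ) : Set Disc :=
  {z | ‖1 - (z : ℂ) * (starRingEnd ℂ) ζ‖ < b / 2 * (1 - ‖(z : ℂ)‖ ^ 2)}

/-! The point is `ζ = 1` and the map is `φ(z) = 1 - ε(1 - z)^a` with `a` and `ε` small. Raising to
the power `a` shrinks the half-plane `Re u > 0` to a narrow sector, so `φ` takes its values in `Γ(1,
b)`, while `‖1 - φ(z)‖ = ε‖1 - z‖^a` exactly. Put `P = 2 + |α|`.

Boundedness. Since `ψ(‖f‖/C)` is subharmonic, a function of modular at most `1` satisfies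
`ψ(‖f(w)‖/C) ≲ (1 - ‖w‖²)^(-P)` (`modular_pointwise`). Inside `Γ(1, b)` the quantity `1 - ‖φ(z)‖²`
dominates `‖1 - φ(z)‖`, hence `(1 - ‖z‖²)^a`. So `ψ(‖f ∘ φ‖/C) ≲ (1 - ‖z‖²)^(-aP)`, which is
integrable once `aP < α + 1` (`exists_modular_comp_le`). Convexity turns this bound on the modular
into a bound on the norm. The growth condition on `ψ` plays no role here.

Non-compactness. The monomials `f_n = x_n z^n` with `ψ(x_n) = n^β / K` lie in the unit ball for `n >
0` and tend to `0` pointwise. Where `‖1 - z‖ < n^(-1/a)`, `φ(z)` is within `1/(2n)` of `1`, so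
`‖φ(z)‖^n ≥ 1/2` and `‖f_n ∘ φ‖ ≥ x_n / 2`. This region has mass at least a constant times
`n^(-P/a)`: only polynomially small. Iterating `Δ²` gives `ψ(C^j x_n) ≥ ψ(x_n)^(2^j)`, a power of
`n` as large as desired, so for a fixed large `j` the modular of `f_n ∘ φ` at `1/(2C^j)` exceeds `1`
eventually. The images therefore stay away from `0` in norm, although `0` is their only possible
limit (`not_isCompactOperator`). -/

namespace OrliczFunction

/-! ### Subharmonicity and pointwise bounds -/

variable (ψ : OrliczFunction)

theorem continuousOn : ContinuousOn ψ (Ici 0) := by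
  intro x hx
  rcases (mem_Ici.1 hx).eq_or_lt with rfl | h
  · exact ψ.continuous_zero'
  · have h1 := ψ.strictConvexOn'.convexOn.continuousOn_interior
    rw [interior_Ici] at h1
    exact (h1.continuousAt (Ioi_mem_nhds h)).continuousWithinAt

/-- Jensen's inequality on circles: `ψ(|F|)` is subharmonic for holomorphic `F`. -/
theorem le_integral_circle {F : ℂ → ℂ} {w : ℂ} {r s : ℝ}
    (hF : DifferentiableOn ℂ F (Metric.ball w r))
    (hs : 0 < s) (hsr : s < r) :
    2 * Real.pi * ψ ‖F w‖ ≤ ∫ θ in Ioo (-Real.pi) Real.pi, ψ ‖F (circleMap w s θ)‖ := by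
  have hsub : Metric.closedBall w s ⊆ Metric.ball w r := Metric.closedBall_subset_ball hsr
  have hd : DiffContOnCl ℂ F (Metric.ball w |s|) := by
    rw [abs_of_pos hs]
    exact (hF.mono hsub).diffContOnCl_ball subset_rfl
  have hmem : ∀ θ, circleMap w s θ ∈ Metric.ball w r := fun θ =>
    hsub (circleMap_mem_closedBall w hs.le θ)
  have hc : Continuous fun θ => F (circleMap w s θ) :=
    hF.continuousOn.comp_continuous (continuous_circleMap w s) hmem
  have hψc : Continuous fun θ => ψ ‖F (circleMap w s θ)‖ :=
    ψ.continuousOn.comp_continuous hc.norm fun θ => norm_nonneg _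
  -- The mean value property and the triangle inequality; Jensen's inequality for `ψ` follows in
  -- `hJ`.
  have hmean : ‖F w‖ ≤ ⨍ θ in Ioc 0 (2 * Real.pi), ‖F (circleMap w s θ)‖ := by
    have h := hd.circleAverage
    rw [Real.circleAverage_eq_intervalAverage, uIoc_of_le Real.two_pi_pos.le, setAverage_eq] at h
    rw [← h, setAverage_eq, norm_smul, Real.norm_of_nonneg (by positivity), smul_eq_mul]
    gcongr
    exact norm_integral_le_integral_norm _
  have hfi : IntegrableOn (fun θ => ‖F (circleMap w s θ)‖) (Ioc 0 (2 * Real.pi)) :=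
    (hc.norm.continuousOn.integrableOn_Icc).mono_set Ioc_subset_Icc_self
  have hgi : IntegrableOn (fun θ => ψ ‖F (circleMap w s θ)‖) (Ioc 0 (2 * Real.pi)) :=
    (hψc.continuousOn.integrableOn_Icc).mono_set Ioc_subset_Icc_self
  have hJ := ψ.strictConvexOn'.convexOn.map_set_average_le (μ := volume)
    (t := Ioc 0 (2 * Real.pi)) ψ.continuousOn isClosed_Ici
    (by simp [Real.pi_pos]) (by rw [Real.volume_Ioc]; exact ENNReal.ofReal_ne_top)
    (Eventually.of_forall fun θ => norm_nonneg _) hfi hgi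
  have h1 := (ψ.mono (norm_nonneg _) hmean).trans hJ
  rw [setAverage_eq, smul_eq_mul, Real.volume_real_Ioc_of_le Real.two_pi_pos.le, sub_zero,
    ← div_eq_inv_mul, le_div_iff₀' Real.two_pi_pos] at h1
  refine h1.trans_eq ?_
  -- By periodicity the integral moves to `(-π, π)`, the angular range of `Complex.polarCoord`.
  rw [← integral_Ioc_eq_integral_Ioo, ← intervalIntegral.integral_of_le Real.two_pi_pos.le,
    ← intervalIntegral.integral_of_le (by linarith [Real.pi_pos])]
  have hp : Function.Periodic (fun θ => ψ ‖F (circleMap w s θ)‖) (2 * Real.pi) := fun θ => by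
    simp only [periodic_circleMap w s θ]
  have := hp.intervalIntegral_add_eq 0 (-Real.pi)
  rw [zero_add, show -Real.pi + 2 * Real.pi = Real.pi by ring] at this
  exact this

end OrliczFunction

/-- A function satisfying the sub-mean value inequality on circles satisfies it on discs. -/
theorem ofReal_le_lintegral_ball_of_le_circle {u : ℂ → ℝ} {w : ℂ} {r : ℝ} (hr : 0 ≤ r)
    (hu : ContinuousOn u (Metric.ball w r)) (h0 : ∀ z, 0 ≤ u z)
    (h : ∀ s, 0 < s → s < r →
      2 * Real.pi * u w ≤ ∫ θ in Ioo (-Real.pi) Real.pi, u (circleMap w s θ)) :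
    ENNReal.ofReal (Real.pi * r ^ 2 * u w) ≤ ∫⁻ z in Metric.ball w r, ENNReal.ofReal (u z) := by
  classical
  set H : ℂ → ℝ≥0∞ := (Metric.ball w r).indicator fun z => ENNReal.ofReal (u z) with hH
  have hHm : Measurable H := by
    rw [hH, ← piecewise_eq_indicator]
    exact ContinuousOn.measurable_piecewise (ENNReal.continuous_ofReal.comp_continuousOn hu)
      continuousOn_const measurableSet_ball
  have e1 : ∫⁻ z in Metric.ball w r, ENNReal.ofReal (u z) = ∫⁻ z, H (w + z) := by
    rw [lintegral_add_left_eq_self H w, hH, lintegral_indicator measurableSet_ball]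
  have e2 : ∀ p : ℝ × ℝ, w + Complex.polarCoord.symm p = circleMap w p.1 p.2 := fun p => by
    rw [Complex.polarCoord_symm_apply, circleMap, Complex.exp_mul_I]
    push_cast; ring
  have hm : Measurable fun p : ℝ × ℝ => ENNReal.ofReal p.1 * H (circleMap w p.1 p.2) := by
    refine (ENNReal.measurable_ofReal.comp measurable_fst).mul (hHm.comp ?_)
    exact Continuous.measurable (by unfold circleMap; fun_prop)
  rw [e1, ← Complex.lintegral_comp_polarCoord_symm]
  simp only [e2, polarCoord_target, smul_eq_mul]
  rw [Measure.volume_eq_prod, ← Measure.prod_restrict, lintegral_prod _ hm.aemeasurable]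
  have key : ∀ s ∈ Ioo 0 r, ENNReal.ofReal (s * (2 * Real.pi * u w)) ≤
      ∫⁻ θ in Ioo (-Real.pi) Real.pi, ENNReal.ofReal s * H (circleMap w s θ) := by
    intro s hs
    have hmem : ∀ θ, circleMap w s θ ∈ Metric.ball w r := fun θ =>
      Metric.closedBall_subset_ball hs.2 (circleMap_mem_closedBall w hs.1.le θ)
    have hc : Continuous fun θ => u (circleMap w s θ) :=
      hu.comp_continuous (continuous_circleMap w s) hmem
    rw [lintegral_const_mul' _ _ ENNReal.ofReal_ne_top, ENNReal.ofReal_mul hs.1.le]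
    gcongr
    simp only [hH, indicator_of_mem (hmem _)]
    rw [← ofReal_integral_eq_lintegral_ofReal
      ((hc.continuousOn.integrableOn_Icc).mono_set Ioo_subset_Icc_self)
      (Eventually.of_forall fun θ => h0 _)]
    exact ENNReal.ofReal_le_ofReal (h s hs.1 hs.2)
  have hint : ∫ s in Ioo 0 r, s * (2 * Real.pi * u w) = Real.pi * r ^ 2 * u w := by
    rw [← integral_Ioc_eq_integral_Ioo, ← intervalIntegral.integral_of_le hr,
      intervalIntegral.integral_mul_const, integral_id]
    ring
  calc ENNReal.ofReal (Real.pi * r ^ 2 * u w)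
      = ∫⁻ s in Ioo 0 r, ENNReal.ofReal (s * (2 * Real.pi * u w)) := by
        rw [← hint, ofReal_integral_eq_lintegral_ofReal]
        · exact (Continuous.integrableOn_Icc (by fun_prop)).mono_set Ioo_subset_Icc_self
        · refine (ae_restrict_iff' measurableSet_Ioo).2 (Eventually.of_forall fun s hs => ?_)
          have := h0 w
          have := hs.1
          have := Real.pi_pos
          dsimp
          positivity
    _ ≤ ∫⁻ s in Ioo 0 r,
          ∫⁻ θ in Ioo (-Real.pi) Real.pi, ENNReal.ofReal s * H (circleMap w s θ) :=
        setLIntegral_mono' measurableSet_Ioo key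
    _ ≤ _ := lintegral_mono_set Ioo_subset_Ioi_self

theorem Disc.one_sub_sq_pos (z : Disc) : 0 < 1 - ‖(z : ℂ)‖ ^ 2 := by
  have h : ‖(z : ℂ)‖ < 1 := mem_ball_zero_iff.1 z.2
  nlinarith [norm_nonneg (z : ℂ)]

theorem measurable_weight (α : ℝ) : Measurable fun z : Disc =>
    ENNReal.ofReal ((α + 1) / Real.pi * (1 - ‖(z : ℂ)‖ ^ 2) ^ α) := by fun_prop

theorem lintegral_weightedMeasure (α : ℝ) {G : ℂ → ℝ≥0∞} (hG : Measurable fun z : Disc => G z) :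
    ∫⁻ z : Disc, G z ∂(weightedMeasure α) = ∫⁻ z in Metric.ball (0 : ℂ) 1,
      ENNReal.ofReal ((α + 1) / Real.pi * (1 - ‖z‖ ^ 2) ^ α) * G z := by
  rw [weightedMeasure, lintegral_withDensity_eq_lintegral_mul _ (measurable_weight α) hG,
    discMeasure, ← lintegral_subtype_comap measurableSet_ball
      (fun z : ℂ => ENNReal.ofReal ((α + 1) / Real.pi * (1 - ‖z‖ ^ 2) ^ α) * G z)]
  rfl

/-- The exponent `|α|` treats both signs of `α` at once. The loss for `α < 0` is harmless, because
the lens exponent is chosen afterwards. -/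
theorem rpow_abs_le_rpow {r t : ℝ} (α : ℝ) (hr : 0 < r) (hrt : r ≤ t) (ht : t ≤ 1) :
    r ^ |α| ≤ t ^ α :=
  (Real.rpow_le_rpow hr.le hrt (abs_nonneg α)).trans
    (Real.rpow_le_rpow_of_exponent_ge (hr.trans_le hrt) ht (le_abs_self α))

/-- Comparison of the weighted measure with Lebesgue measure on a disc at distance at least its
radius from the unit circle. -/
theorem mul_lintegral_ball_le {α : ℝ} (hα : -1 < α) {G : ℂ → ℝ≥0∞}
    (hG : Measurable fun z : Disc => G z) {w : ℂ} {r : ℝ} (hr : 0 < r) (hw : ‖w‖ + 2 * r ≤ 1) :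
    ENNReal.ofReal ((α + 1) / Real.pi * r ^ |α|) * ∫⁻ z in Metric.ball w r, G z
      ≤ ∫⁻ z : Disc, G z ∂(weightedMeasure α) := by
  have h0 : 0 < α + 1 := by linarith
  have hnorm : ∀ z ∈ Metric.ball w r, ‖z‖ < 1 - r := fun z hz => by
    have h1 : ‖z - w‖ < r := mem_ball_iff_norm.1 hz
    have h2 := norm_add_le (z - w) w
    rw [sub_add_cancel] at h2
    linarith
  rw [lintegral_weightedMeasure α hG, ← lintegral_const_mul' _ _ ENNReal.ofReal_ne_top]
  calc ∫⁻ z in Metric.ball w r, ENNReal.ofReal ((α + 1) / Real.pi * r ^ |α|) * G z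
      ≤ ∫⁻ z in Metric.ball w r,
          ENNReal.ofReal ((α + 1) / Real.pi * (1 - ‖z‖ ^ 2) ^ α) * G z := by
        refine setLIntegral_mono' measurableSet_ball fun z hz => ?_
        have h1 := hnorm z hz
        have h2 := norm_nonneg z
        gcongr ENNReal.ofReal (_ * ?_) * _
        exact rpow_abs_le_rpow α hr (by nlinarith) (by nlinarith)
    _ ≤ _ := lintegral_mono_set fun z hz =>
        mem_ball_zero_iff.2 ((hnorm z hz).trans (by linarith))

/-- The sub-mean value inequality on a disc around `w` of radius comparable to `1 - ‖w‖²`: the area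
contributes the exponent `2`, the weight contributes `|α|`. -/
theorem modular_pointwise (ψ : OrliczFunction) {α : ℝ} (hα : -1 < α) {f : Disc → ℂ} (hf : IsHolo f)
    {C : ℝ} (hC : 0 < C) (h : modular ψ α f C ≤ 1) (w : Disc) :
    (α + 1) * ((1 - ‖(w : ℂ)‖ ^ 2) / 4) ^ (2 + |α|) * ψ (‖f w‖ / C) ≤ 1 := by
  have h0 : 0 < α + 1 := by linarith
  obtain ⟨F, hF, hfF⟩ := id hf
  -- The factor `4` gives `‖w‖ + 2r ≤ 1`, which amounts to `(1 - ‖w‖)² ≥ 0`.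
  set r : ℝ := (1 - ‖(w : ℂ)‖ ^ 2) / 4 with hr_def
  have hr : 0 < r := by have := w.one_sub_sq_pos; positivity
  have hwr : ‖(w : ℂ)‖ + 2 * r ≤ 1 := by
    rw [hr_def]; nlinarith [sq_nonneg (1 - ‖(w : ℂ)‖)]
  have hsub : Metric.ball (w : ℂ) r ⊆ Metric.ball 0 1 := by
    refine Metric.ball_subset_ball' ?_
    rw [dist_zero_right]; linarith
  have hnorm : ∀ z, ‖F z / C‖ = ‖F z‖ / C := fun z => by
    rw [norm_div, Complex.norm_real, Real.norm_of_nonneg hC.le]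
  have hnorm' : ∀ z : Disc, ‖F z / C‖ = ‖f z‖ / C := fun z => by rw [hnorm, hfF]
  have hFd : DifferentiableOn ℂ (fun z => F z / C) (Metric.ball (w : ℂ) r) :=
    (hF.mono hsub).div_const _
  have h1 := ofReal_le_lintegral_ball_of_le_circle (u := fun z => ψ ‖F z / C‖) (w := (w : ℂ)) hr.le
    (ψ.continuousOn.comp hFd.continuousOn.norm fun z _ => norm_nonneg _)
    (fun z => ψ.nonneg' _ (norm_nonneg _))
    (fun s hs hsr => ψ.le_integral_circle hFd hs hsr)
  have hG : Measurable fun z : Disc => ENNReal.ofReal (ψ ‖F z / C‖) := by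
    simp only [hnorm']
    exact ψ.measurable_comp_norm hf.continuous C hC
  have h2 := mul_lintegral_ball_le hα (G := fun z => ENNReal.ofReal (ψ ‖F z / C‖)) hG hr hwr
  have h3 : ∫⁻ z : Disc, ENNReal.ofReal (ψ ‖F z / C‖) ∂(weightedMeasure α) ≤ 1 := by
    simp only [hnorm']
    exact h
  have h4 := (mul_le_mul_right h1 (ENNReal.ofReal ((α + 1) / Real.pi * r ^ |α|))).trans
    (h2.trans h3)
  have hpi := Real.pi_pos
  rw [← ENNReal.ofReal_mul (by positivity), ENNReal.ofReal_le_one] at h4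
  refine le_trans (le_of_eq ?_) h4
  rw [hnorm', Real.rpow_add hr, Real.rpow_two]
  field_simp

/-- The integrand times the density of `v_α` is a constant multiple of the density of the
probability measure `v_(α - s)`. -/
theorem lintegral_rpow_neg {α s : ℝ} (hα : -1 < α) (hs : s < α + 1) :
    ∫⁻ z : Disc, ENNReal.ofReal ((1 - ‖(z : ℂ)‖ ^ 2) ^ (-s)) ∂(weightedMeasure α)
      = ENNReal.ofReal ((α + 1) / (α - s + 1)) := by
  have h0 : 0 < α + 1 := by linarith
  have h1 : 0 < α - s + 1 := by linarith
  rw [weightedMeasure, lintegral_withDensity_eq_lintegral_mul _ (measurable_weight α)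
    (by fun_prop)]
  have h2 := weightedMeasure_univ (α := α - s) (by linarith)
  rw [weightedMeasure, withDensity_apply _ MeasurableSet.univ, Measure.restrict_univ] at h2
  rw [← mul_one (ENNReal.ofReal _), ← h2, ← lintegral_const_mul' _ _ ENNReal.ofReal_ne_top]
  refine lintegral_congr fun z => ?_
  have hz := z.one_sub_sq_pos
  simp only [Pi.mul_apply]
  rw [← ENNReal.ofReal_mul (by positivity), ← ENNReal.ofReal_mul (by positivity)]
  congr 1
  rw [sub_eq_add_neg α s, Real.rpow_add hz]
  rw [sub_eq_add_neg] at h1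
  field_simp

/-! ### The lens map -/

theorem Disc.one_sub_re_pos (z : Disc) : 0 < (1 - (z : ℂ)).re := by
  have h : ‖(z : ℂ)‖ < 1 := mem_ball_zero_iff.1 z.2
  have := Complex.re_le_norm (z : ℂ)
  simp only [Complex.sub_re, Complex.one_re]
  linarith

/-- The perturbed lens map `z ↦ 1 - ε (1 - z) ^ a` sends the disc into `Γ(1, b)` for small `a`
and `ε`. -/
theorem norm_lens_lt {a b ε : ℝ} (ha : 0 < a) (ha1 : a ≤ 1) (hb : 1 < b)
    (hcos : (1 + 1 / b) / 2 ≤ Real.cos (Real.pi / 2 * a)) (hε : 0 < ε)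
    (hεb : ε ≤ (1 - 1 / b) / 4) (z : Disc) :
    ‖(ε : ℂ) * (1 - z) ^ (a : ℂ)‖
      < b / 2 * (1 - ‖1 - (ε : ℂ) * (1 - z) ^ (a : ℂ)‖ ^ 2) := by
  have hz : ‖(z : ℂ)‖ < 1 := mem_ball_zero_iff.1 z.2
  set u : ℂ := 1 - z with hu
  have hre : 0 < u.re := z.one_sub_re_pos
  have hu0 : u ≠ 0 := fun h => by simp [h] at hre
  have hu2 : ‖u‖ ≤ 2 := by
    refine (norm_sub_le _ _).trans ?_
    rw [norm_one]; linarith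
  set v : ℂ := (ε : ℂ) * u ^ (a : ℂ) with hv
  have hvn : ‖v‖ = ε * ‖u‖ ^ a := by
    rw [hv, norm_mul, Complex.norm_real, Real.norm_of_nonneg hε.le, Complex.norm_cpow_real]
  have hv0 : 0 < ‖v‖ := by rw [hvn]; positivity
  have hv2 : ‖v‖ ≤ 2 * ε := by
    rw [hvn, mul_comm]
    gcongr
    calc ‖u‖ ^ a ≤ 2 ^ a := by gcongr
      _ ≤ 2 ^ (1 : ℝ) := Real.rpow_le_rpow_of_exponent_le one_le_two ha1
      _ = 2 := Real.rpow_one 2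
  -- `u` lies in the right half-plane, so the argument of `v` is at most `aπ/2` in absolute value
  -- and `Re v ≥ cos(aπ/2) ‖v‖`.
  have hvre : (1 + 1 / b) / 2 * ‖v‖ ≤ v.re := by
    have harg : |u.arg| ≤ Real.pi / 2 := Complex.abs_arg_le_pi_div_two_iff.2 hre.le
    have h1 : Real.cos (Real.pi / 2 * a) ≤ Real.cos (u.arg * a) := by
      rw [← Real.cos_abs (u.arg * a), abs_mul, abs_of_pos ha]
      refine Real.cos_le_cos_of_nonneg_of_le_pi (by positivity) ?_ (by gcongr)
      nlinarith [Real.pi_pos]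
    rw [hv, Complex.re_ofReal_mul, Complex.cpow_ofReal_re, ← hv, hvn]
    have h2 : 0 ≤ ε * ‖u‖ ^ a := by positivity
    nlinarith [mul_le_mul_of_nonneg_left (hcos.trans h1) h2]
  have hsq : ‖1 - v‖ ^ 2 = 1 - 2 * v.re + ‖v‖ ^ 2 := by
    rw [Complex.sq_norm, Complex.sq_norm, Complex.normSq_apply, Complex.normSq_apply]
    simp only [Complex.sub_re, Complex.one_re, Complex.sub_im, Complex.one_im]
    ring
  rw [hsq]
  have hb0 : 0 < b := by linarith
  -- From `‖v‖ ≤ 2ε ≤ (1 - 1/b)/2`. Multiplied by `b/2`, the left side becomes `b/4 + 3/4`, which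
  -- exceeds `1` exactly because `b > 1`.
  have h3 : 1 / 2 + 3 / 2 * (1 / b) ≤ 2 * ((1 + 1 / b) / 2) - ‖v‖ := by linarith
  have h4 : ‖v‖ * (1 / 2 + 3 / 2 * (1 / b)) ≤ 1 - (1 - 2 * v.re + ‖v‖ ^ 2) := by
    nlinarith [mul_le_mul_of_nonneg_left h3 hv0.le]
  calc ‖v‖ < ‖v‖ * (b / 4 + 3 / 4) := by nlinarith
    _ = b / 2 * (‖v‖ * (1 / 2 + 3 / 2 * (1 / b))) := by field_simp; ring
    _ ≤ _ := by gcongr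

/-- The condition `a * P < δ` will be used with `P = 2 + |α|` and `δ = α + 1`, as the integrability
threshold for boundedness. -/
theorem exists_lens_map {b : ℝ} (hb : 1 < b) (P : ℝ) {δ : ℝ} (hδ : 0 < δ) :
    ∃ (a ε : ℝ) (φ : Disc → Disc), 0 < a ∧ 0 < ε ∧ ε ≤ 1 / 2 ∧ a * P < δ ∧
      IsHolo (fun z => (φ z : ℂ)) ∧ Set.range φ ⊆ approachRegion 1 b ∧
      ∀ z, ‖1 - (φ z : ℂ)‖ = ε * ‖1 - (z : ℂ)‖ ^ a := by
  have hb0 : 0 < b := by linarith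
  have hb1 : 1 / b < 1 := (div_lt_one hb0).2 hb
  have h1 : ∀ᶠ a : ℝ in 𝓝[>] 0, (1 + 1 / b) / 2 < Real.cos (Real.pi / 2 * a) := by
    refine Tendsto.eventually_const_lt (v := 1) (by linarith)
      (Tendsto.mono_left ?_ nhdsWithin_le_nhds)
    have : Continuous fun a : ℝ => Real.cos (Real.pi / 2 * a) := by fun_prop
    simpa using this.tendsto 0
  have h2 : ∀ᶠ a : ℝ in 𝓝[>] 0, a * P < δ := by
    refine Tendsto.eventually_lt_const (v := 0) hδ (Tendsto.mono_left ?_ nhdsWithin_le_nhds)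
    have : Continuous fun a : ℝ => a * P := by fun_prop
    simpa using this.tendsto 0
  have h3 : ∀ᶠ a : ℝ in 𝓝[>] 0, a ≤ 1 :=
    Filter.mem_of_superset (Ioc_mem_nhdsGT one_pos) fun a h => h.2
  obtain ⟨a, hcos, haP, ha1, ha⟩ := (h1.and (h2.and (h3.and self_mem_nhdsWithin))).exists
  have ha : 0 < a := ha
  set ε := (1 - 1 / b) / 4 with hε_def
  have hε : 0 < ε := by rw [hε_def]; linarith
  have key := norm_lens_lt ha ha1 hb hcos.le hε le_rfl
  have hmem : ∀ z : Disc, 1 - (ε : ℂ) * (1 - z) ^ (a : ℂ) ∈ Metric.ball (0 : ℂ) 1 := fun z => by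
    rw [mem_ball_zero_iff]
    have h := (norm_nonneg _).trans_lt (key z)
    have h' := pos_of_mul_pos_right h (by positivity)
    nlinarith [norm_nonneg (1 - (ε : ℂ) * (1 - z) ^ (a : ℂ))]
  refine ⟨a, ε, fun z => ⟨_, hmem z⟩, ha, hε, ?_, haP,
    ⟨fun z => 1 - (ε : ℂ) * (1 - z) ^ (a : ℂ), ?_, fun z => rfl⟩, ?_, fun z => ?_⟩
  · have : 0 < 1 / b := by positivity
    rw [hε_def]; linarith
  · intro z hz
    refine DifferentiableAt.differentiableWithinAt ?_
    refine (differentiableAt_const _).sub ((differentiableAt_const _).mul ?_)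
    exact ((differentiableAt_const _).sub differentiableAt_id).cpow_const
      (Or.inl (Disc.one_sub_re_pos ⟨z, hz⟩))
  · rintro _ ⟨z, rfl⟩
    simpa [approachRegion] using key z
  · simp only [sub_sub_cancel]
    rw [norm_mul, Complex.norm_real, Real.norm_of_nonneg hε.le, Complex.norm_cpow_real]

/-! ### Boundedness of the composition operator -/

theorem IsHolo.comp {f : Disc → ℂ} (hf : IsHolo f) {φ : Disc → Disc}
    (hφ : IsHolo fun z => (φ z : ℂ)) : IsHolo fun z => f (φ z) := by
  obtain ⟨F, hF, hfF⟩ := hf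
  obtain ⟨Φ, hΦ, hφΦ⟩ := hφ
  refine ⟨F ∘ Φ, hF.comp hΦ fun z hz => ?_, fun z => by simp [hfF, hφΦ]⟩
  rw [← hφΦ ⟨z, hz⟩]
  exact (φ ⟨z, hz⟩).2

/-- A self-map of the disc that stays far enough from the boundary acts boundedly on the unit ball
of the Bergman-Orlicz space. -/
theorem exists_modular_comp_le (ψ : OrliczFunction) {α : ℝ} (hα : -1 < α) {φ : Disc → Disc}
    {a c : ℝ} (hc : 0 < c) (haP : a * (2 + |α|) < α + 1)
    (hφ : ∀ z : Disc, c * (1 - ‖(z : ℂ)‖ ^ 2) ^ a ≤ 1 - ‖(φ z : ℂ)‖ ^ 2) :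
    ∃ M : ℝ, 1 ≤ M ∧ ∀ (f : Disc → ℂ) (C : ℝ), IsHolo f → 0 < C → modular ψ α f C ≤ 1 →
      modular ψ α (fun z => f (φ z)) C ≤ ENNReal.ofReal M := by
  have h0 : 0 < α + 1 := by linarith
  set P := 2 + |α| with hP
  have hP0 : 0 < P := by positivity
  -- `A` is the constant of the pointwise bound at `φ z`, and `B` is the integral of `(1 -
  -- ‖z‖²)^(-aP)`.
  set A : ℝ := 1 / ((α + 1) * (c / 4) ^ P) with hA
  set B : ℝ := (α + 1) / (α - a * P + 1) with hB
  refine ⟨max 1 (A * B), le_max_left _ _, fun f C hf hC h => ?_⟩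
  refine le_trans ?_ (ENNReal.ofReal_le_ofReal (le_max_right _ _))
  rw [ENNReal.ofReal_mul (by positivity), hB, ← lintegral_rpow_neg hα haP,
    ← lintegral_const_mul' _ _ ENNReal.ofReal_ne_top]
  refine lintegral_mono fun z => ?_
  have hz := z.one_sub_sq_pos
  rw [← ENNReal.ofReal_mul (by positivity)]
  refine ENNReal.ofReal_le_ofReal ?_
  have h1 := modular_pointwise ψ hα hf hC h (φ z)
  have hψ := ψ.nonneg' (‖f (φ z)‖ / C) (by positivity)
  have h2 : (α + 1) * (c / 4) ^ P * (1 - ‖(z : ℂ)‖ ^ 2) ^ (a * P) * ψ (‖f (φ z)‖ / C) ≤ 1 := by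
    refine le_trans ?_ h1
    rw [Real.rpow_mul hz.le, mul_assoc (α + 1), ← Real.mul_rpow (by positivity) (by positivity)]
    gcongr
    linarith [hφ z]
  rw [Real.rpow_neg hz.le, hA, ← div_eq_mul_inv, div_div, le_div_iff₀ (by positivity)]
  linarith

/-- The composition operator, given a bound on the modular. -/
theorem exists_compositionOperator (ψ : OrliczFunction) {α : ℝ} (hα : -1 < α) {φ : Disc → Disc}
    (hφ : IsHolo fun z => (φ z : ℂ)) {M : ℝ} (hM : 1 ≤ M)
    (h : ∀ (f : Disc → ℂ) (C : ℝ), IsHolo f → 0 < C → modular ψ α f C ≤ 1 →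
      modular ψ α (fun z => f (φ z)) C ≤ ENNReal.ofReal M) :
    ∃ T : BergmanOrlicz ψ hα →L[ℂ] BergmanOrlicz ψ hα, ∀ f z, T f z = f (φ z) := by
  have hmem : ∀ f : BergmanOrlicz ψ hα, (fun z => f (φ z)) ∈ bergmanOrliczSubmodule ψ α := by
    intro f
    obtain ⟨C, hC, hfC⟩ := f.nonempty
    exact ⟨f.isHolo.comp hφ, C, hC, (h f C f.isHolo hC hfC).trans_lt ENNReal.ofReal_lt_top⟩
  let L : BergmanOrlicz ψ hα →ₗ[ℂ] BergmanOrlicz ψ hα :=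
    { toFun := fun f => ⟨fun z => f (φ z), hmem f⟩
      map_add' := fun f g => rfl
      map_smul' := fun c f => rfl }
  refine ⟨L.mkContinuous M fun f => ?_, fun f z => rfl⟩
  have hM0 : 0 < M := by linarith
  rw [← div_le_iff₀' hM0]
  refine le_of_forall_gt fun r hr => ?_
  obtain ⟨C, hC, hCr, hfC⟩ := BergmanOrlicz.exists_of_norm_lt hr
  refine lt_of_le_of_lt ?_ hCr
  rw [div_le_iff₀' hM0]
  -- By convexity, a modular at most `M` at level `C` is at most `1` at level `M * C`.
  refine BergmanOrlicz.norm_le (by positivity) ((modular_mul_le ψ α _ hM hC).trans ?_)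
  refine (mul_le_mul_right (h f C f.isHolo hC hfC) _).trans ?_
  rw [← ENNReal.ofReal_mul (by positivity), one_div_mul_cancel hM0.ne', ENNReal.ofReal_one]

/-! ### Growth of the Orlicz function -/

namespace OrliczFunction

variable (ψ : OrliczFunction)

theorem eventually_le_self : ∀ᶠ x in atTop, x ≤ ψ x := by
  filter_upwards [ψ.tendsto_div'.eventually_ge_atTop 1, eventually_gt_atTop 0] with x h1 h0
  exact (one_le_div h0).1 h1

theorem tendsto_atTop : Tendsto ψ atTop atTop :=
  tendsto_atTop_mono' _ ψ.eventually_le_self tendsto_id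

theorem exists_eq {y : ℝ} (hy : 0 ≤ y) : ∃ x, 0 ≤ x ∧ ψ x = y := by
  obtain ⟨b, hb, hb0⟩ :=
    ((ψ.tendsto_atTop.eventually_ge_atTop y).and (eventually_ge_atTop 0)).exists
  have h := intermediate_value_Icc hb0 (ψ.continuousOn.mono Icc_subset_Ici_self)
  rw [ψ.map_zero'] at h
  obtain ⟨x, hx, hxy⟩ := h ⟨hy, hb⟩
  exact ⟨x, hx.1, hxy⟩

theorem le_of_map_lt {x y : ℝ} (hx : 0 ≤ x) (h : ψ y < ψ x) : y ≤ x := by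
  by_contra! hlt
  exact (ψ.mono hx hlt.le).not_gt h

theorem DeltaSup2.iterate {ψ : OrliczFunction} (h : ψ.DeltaSup2) :
    ∃ C : ℝ, 1 ≤ C ∧ ∃ x₀ : ℝ, 0 < x₀ ∧ ∀ (j : ℕ) (x : ℝ), x₀ ≤ x →
      ψ x ^ 2 ^ j ≤ ψ (C ^ j * x) := by
  obtain ⟨C, hC, x₀, hx₀, h⟩ := h
  -- Enlarging the constant to at least `1` keeps every iterate `C^j x` above the threshold `x₀`.
  have hC1 : 1 ≤ max C 1 := le_max_right _ _
  refine ⟨max C 1, hC1, x₀, hx₀, fun j x hx => ?_⟩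
  have hx0 : 0 ≤ x := hx₀.le.trans hx
  induction j with
  | zero => simp
  | succ j ih =>
    have h1 : x₀ ≤ max C 1 ^ j * x := hx.trans (le_mul_of_one_le_left hx0 (one_le_pow₀ hC1))
    calc ψ x ^ 2 ^ (j + 1) = (ψ x ^ 2 ^ j) ^ 2 := by rw [← pow_mul, pow_succ]
      _ ≤ ψ (max C 1 ^ j * x) ^ 2 :=
        pow_le_pow_left₀ (pow_nonneg (ψ.nonneg' _ hx0) _) ih 2
      _ ≤ ψ (C * (max C 1 ^ j * x)) := h _ h1
      _ ≤ ψ (max C 1 ^ (j + 1) * x) := by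
        refine ψ.mono (by positivity) ?_
        rw [pow_succ', mul_assoc]
        gcongr
        exact le_max_left _ _

end OrliczFunction

/-! ### Integrals of monomials and mass near the point 1 -/

/-- With `y = n(1 - ‖z‖²)/2` one has `‖z‖^n ≤ exp(-y)`, and `y^β ≤ exp y` for `0 ≤ β ≤ 1`. -/
theorem pow_norm_le_rpow {β : ℝ} (hβ : 0 ≤ β) (hβ1 : β ≤ 1) {n : ℕ} (hn : 0 < n) (z : Disc) :
    ‖(z : ℂ)‖ ^ n ≤ 2 ^ β * (n : ℝ) ^ (-β) * (1 - ‖(z : ℂ)‖ ^ 2) ^ (-β) := by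
  have hz := z.one_sub_sq_pos
  set q := 1 - ‖(z : ℂ)‖ ^ 2 with hq
  have hn' : (0 : ℝ) < n := by exact_mod_cast hn
  set y : ℝ := n * q / 2 with hy
  have hy0 : 0 < y := by positivity
  have h1 : y ^ β ≤ Real.exp y := by
    rcases le_total y 1 with h | h
    · exact (Real.rpow_le_one hy0.le h hβ).trans (Real.one_le_exp hy0.le)
    · calc y ^ β ≤ y ^ (1 : ℝ) := Real.rpow_le_rpow_of_exponent_le h hβ1
        _ = y := Real.rpow_one y
        _ ≤ Real.exp y := by linarith [Real.add_one_le_exp y]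
  have h2 : ‖(z : ℂ)‖ ≤ Real.exp (-(q / 2)) := by
    refine le_of_sq_le_sq ?_ (Real.exp_pos _).le
    rw [← Real.exp_nat_mul]
    have := Real.add_one_le_exp (-q)
    rw [show ((2 : ℕ) : ℝ) * -(q / 2) = -q by push_cast; ring]
    linarith
  have e : 2 ^ β * (n : ℝ) ^ (-β) * q ^ (-β) = (y ^ β)⁻¹ := by
    rw [hy, Real.div_rpow (by positivity) (by positivity), Real.mul_rpow hn'.le hz.le,
      Real.rpow_neg hn'.le, Real.rpow_neg hz.le]
    field_simp
  calc ‖(z : ℂ)‖ ^ n ≤ Real.exp (-(q / 2)) ^ n := by gcongr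
    _ = (Real.exp y)⁻¹ := by
      rw [← Real.exp_nat_mul, ← Real.exp_neg]
      congr 1
      rw [hy]; ring
    _ ≤ (y ^ β)⁻¹ := by gcongr
    _ = _ := e.symm

/-- Polynomial decay of the norms of the monomials in `L¹(v_α)`. -/
theorem exists_lintegral_pow_le {α : ℝ} (hα : -1 < α) :
    ∃ K β : ℝ, 0 < K ∧ 0 < β ∧ β ≤ 1 ∧ ∀ n : ℕ, 0 < n →
      ∫⁻ z : Disc, ENNReal.ofReal (‖(z : ℂ)‖ ^ n) ∂(weightedMeasure α)
        ≤ ENNReal.ofReal (K * (n : ℝ) ^ (-β)) := by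
  have h0 : 0 < α + 1 := by linarith
  -- `β ≤ 1` serves the bound on `‖z‖^n`, `β < α + 1` the integrability of `(1 - ‖z‖²)^(-β)`.
  set β := min 1 ((α + 1) / 2) with hβ
  have hβ0 : 0 < β := lt_min one_pos (by linarith)
  have hβα : β < α + 1 := (min_le_right _ _).trans_lt (by linarith)
  have h1 : 0 < α - β + 1 := by linarith
  refine ⟨2 ^ β * ((α + 1) / (α - β + 1)), β, by positivity, hβ0, min_le_left _ _,
    fun n hn => ?_⟩
  rw [mul_right_comm, ENNReal.ofReal_mul (by positivity), ← lintegral_rpow_neg hα hβα,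
    ← lintegral_const_mul' _ _ ENNReal.ofReal_ne_top]
  refine lintegral_mono fun z => ?_
  rw [← ENNReal.ofReal_mul (by positivity)]
  exact ENNReal.ofReal_le_ofReal (pow_norm_le_rpow hβ0.le (min_le_left _ _) hn z)

/-- A lower bound for integrals near the boundary point `1`. -/
theorem mul_le_lintegral_near_one {α : ℝ} (hα : -1 < α) {ρ : ℝ} (hρ : 0 < ρ) (hρ1 : ρ ≤ 1)
    {u : Disc → ℝ≥0∞} {y : ℝ≥0∞} (hu : ∀ z : Disc, ‖1 - (z : ℂ)‖ < ρ → y ≤ u z) :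
    ENNReal.ofReal ((α + 1) * (ρ / 4) ^ (2 + |α|)) * y ≤ ∫⁻ z, u z ∂(weightedMeasure α) := by
  have h0 : 0 < α + 1 := by linarith
  set E : Set ℂ := {z | ‖1 - z‖ < ρ} with hE
  have hEm : MeasurableSet E := (isOpen_lt (by fun_prop) continuous_const).measurableSet
  -- The disc of centre `1 - ρ/2` and radius `ρ/4` lies within `ρ` of `1`, yet far enough from the
  -- circle for `mul_lintegral_ball_le`.
  have hw : ‖((1 - ρ / 2 : ℝ) : ℂ)‖ + 2 * (ρ / 4) ≤ 1 := by
    rw [Complex.norm_real, Real.norm_of_nonneg (by linarith)]; linarith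
  have hsub : Metric.ball ((1 - ρ / 2 : ℝ) : ℂ) (ρ / 4) ⊆ E := fun z hz => by
    have h1 : ‖z - ((1 - ρ / 2 : ℝ) : ℂ)‖ < ρ / 4 := mem_ball_iff_norm.1 hz
    have h2 : 1 - z = ((ρ / 2 : ℝ) : ℂ) - (z - ((1 - ρ / 2 : ℝ) : ℂ)) := by push_cast; ring
    have h3 : ‖((ρ / 2 : ℝ) : ℂ)‖ = ρ / 2 := by
      rw [Complex.norm_real, Real.norm_of_nonneg (by linarith)]
    rw [hE, mem_ofPred_eq, h2]
    refine (norm_sub_le _ _).trans_lt ?_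
    linarith
  have h1 := mul_lintegral_ball_le hα (G := E.indicator fun _ => y)
    ((measurable_const.indicator hEm).comp measurable_subtype_coe) (r := ρ / 4) (by positivity) hw
  have h2 : ∫⁻ z in Metric.ball ((1 - ρ / 2 : ℝ) : ℂ) (ρ / 4), E.indicator (fun _ => y) z
      = y * ENNReal.ofReal (Real.pi * (ρ / 4) ^ 2) := by
    rw [setLIntegral_congr_fun measurableSet_ball fun z hz => indicator_of_mem (hsub hz) _,
      setLIntegral_const, Complex.volume_ball, mul_comm Real.pi, ENNReal.ofReal_mul (by positivity),
      ENNReal.ofReal_pow (by positivity)]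
    congr 2
    exact (ENNReal.ofReal_coe_nnreal (p := NNReal.pi)).symm
  rw [h2, mul_left_comm, ← ENNReal.ofReal_mul (by positivity), mul_comm y] at h1
  refine le_trans (le_of_eq ?_) (h1.trans (lintegral_mono fun z => ?_))
  · congr 2
    rw [Real.rpow_add (by positivity), Real.rpow_two]
    field_simp
  · by_cases hz : (z : ℂ) ∈ E
    · rw [indicator_of_mem hz]; exact hu z hz
    · rw [indicator_of_notMem hz]; exact zero_le

/-! ### A criterion for non-compactness -/

namespace BergmanOrlicz

variable {ψ : OrliczFunction} {α : ℝ} {hα : -1 < α}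

/-- Point evaluations are bounded: `modular_pointwise` bounds `ψ(‖f w‖ / C)`, and `ψ → ∞` converts
this into a bound on `‖f w‖ / C`. -/
theorem exists_norm_apply_le (w : Disc) :
    ∃ L : ℝ, ∀ f : BergmanOrlicz ψ hα, ‖f w‖ ≤ L * ‖f‖ := by
  have h0 : 0 < α + 1 := by linarith
  have hw := w.one_sub_sq_pos
  set B : ℝ := (α + 1) * ((1 - ‖(w : ℂ)‖ ^ 2) / 4) ^ (2 + |α|) with hB
  have hB0 : 0 < B := by positivity
  obtain ⟨L, hL, hL0⟩ :=
    ((ψ.tendsto_atTop.eventually_gt_atTop (1 / B)).and (eventually_gt_atTop 0)).exists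
  refine ⟨L, fun f => ?_⟩
  rw [← div_le_iff₀' hL0]
  refine le_of_forall_gt fun r hr => ?_
  obtain ⟨C, hC, hCr, hfC⟩ := exists_of_norm_lt hr
  refine lt_of_le_of_lt ?_ hCr
  rw [div_le_iff₀' hL0, ← div_le_iff₀ hC]
  refine ψ.le_of_map_lt hL0.le (lt_of_le_of_lt ?_ hL)
  rw [le_div_iff₀' hB0]
  exact modular_pointwise ψ hα f.isHolo hC hfC w

theorem tendsto_apply {ι : Type*} {l : Filter ι} {g : ι → BergmanOrlicz ψ hα}
    {g₀ : BergmanOrlicz ψ hα} (h : Tendsto g l (𝓝 g₀)) (w : Disc) :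
    Tendsto (fun i => g i w) l (𝓝 (g₀ w)) := by
  obtain ⟨L, hL⟩ := exists_norm_apply_le (ψ := ψ) (hα := hα) w
  rw [tendsto_iff_norm_sub_tendsto_zero] at h ⊢
  refine squeeze_zero (fun _ => norm_nonneg _) (fun i => hL (g i - g₀)) ?_
  simpa using h.const_mul L

theorem le_norm_of_one_lt_modular {f : BergmanOrlicz ψ hα} {δ : ℝ}
    (h : 1 < modular ψ α f δ) : δ ≤ ‖f‖ := by
  by_contra! hlt
  obtain ⟨C, hC, hCδ, hfC⟩ := exists_of_norm_lt hlt
  have hK : 1 ≤ δ / C := (one_le_div hC).2 hCδ.le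
  have h1 := modular_mul_le ψ α f hK hC
  rw [div_mul_cancel₀ _ hC.ne'] at h1
  refine (h1.trans (mul_le_one' ?_ hfC)).not_gt h
  rw [ENNReal.ofReal_le_one, div_le_one (by linarith)]
  exact hK

/-- A bounded sequence of functions that tends to `0` pointwise after composition, but not in norm,
prevents compactness. -/
theorem not_isCompactOperator {T : BergmanOrlicz ψ hα →L[ℂ] BergmanOrlicz ψ hα}
    {f : ℕ → BergmanOrlicz ψ hα} (hf : ∀ᶠ n in atTop, ‖f n‖ ≤ 1)
    (h0 : ∀ z, Tendsto (fun n => T (f n) z) atTop (𝓝 0)) {δ : ℝ} (hδ : 0 < δ)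
    (hT : ∀ᶠ n in atTop, δ ≤ ‖T (f n)‖) : ¬ IsCompactOperator T := by
  intro hc
  obtain ⟨K, hK, hKT⟩ := IsCompactOperator.image_closedBall_subset_compact
    (f := (T : BergmanOrlicz ψ hα →ₗ[ℂ] BergmanOrlicz ψ hα)) hc 1
  obtain ⟨N, hN⟩ := eventually_atTop.1 hf
  obtain ⟨g, -, k, hk, hkg⟩ := hK.tendsto_subseq (x := fun n => T (f (n + N))) fun n =>
    hKT ⟨f (n + N), by simpa using hN (n + N) (by lia), rfl⟩
  have hsub : Tendsto (fun n => k n + N) atTop atTop :=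
    (tendsto_add_atTop_nat N).comp hk.tendsto_atTop
  -- Norm convergence implies pointwise convergence, so the pointwise limit `0` identifies `g`.
  have hg : g = 0 := ext fun z =>
    tendsto_nhds_unique (tendsto_apply hkg z) ((h0 z).comp hsub)
  rw [hg] at hkg
  have h1 := hkg.norm
  rw [norm_zero] at h1
  have h2 := ge_of_tendsto h1 (hsub.eventually hT)
  linarith

end BergmanOrlicz

/-! ### Normalized monomials -/

theorem IsHolo.const_mul_pow (x : ℝ) (n : ℕ) : IsHolo fun z => (x : ℂ) * (z : ℂ) ^ n :=
  ⟨fun z => (x : ℂ) * z ^ n, by fun_prop, fun _ => rfl⟩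

theorem norm_const_mul_pow {x : ℝ} (hx : 0 ≤ x) (n : ℕ) (z : ℂ) :
    ‖(x : ℂ) * z ^ n‖ = x * ‖z‖ ^ n := by
  rw [norm_mul, norm_pow, Complex.norm_real, Real.norm_of_nonneg hx]

/-- Monomials, normalized so that their modular is at most `1`. -/
theorem exists_normalized_monomials (ψ : OrliczFunction) {α : ℝ} (hα : -1 < α) :
    ∃ K β : ℝ, 0 < K ∧ 0 < β ∧ β ≤ 1 ∧ ∃ x : ℕ → ℝ, ∃ f : ℕ → BergmanOrlicz ψ hα,
      (∀ n, 0 ≤ x n) ∧ (∀ n, ψ (x n) = (n : ℝ) ^ β / K) ∧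
      (∀ n z, f n z = (x n : ℂ) * (z : ℂ) ^ n) ∧ ∀ n, 0 < n → ‖f n‖ ≤ 1 := by
  obtain ⟨K, β, hK, hβ, hβ1, hKβ⟩ := exists_lintegral_pow_le hα
  have hex : ∀ n : ℕ, ∃ x, 0 ≤ x ∧ ψ x = (n : ℝ) ^ β / K := fun n => ψ.exists_eq (by positivity)
  choose x hx0 hx using hex
  -- Convexity and `ψ 0 = 0` give `ψ(s x) ≤ s ψ(x)` with `s = ‖z‖^n`, reducing the modular to an
  -- `L¹` integral.
  have hle : ∀ (n : ℕ) (z : Disc), ψ (‖(x n : ℂ) * (z : ℂ) ^ n‖ / 1)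
      ≤ (n : ℝ) ^ β / K * ‖(z : ℂ)‖ ^ n := fun n z => by
    have hz : ‖(z : ℂ)‖ < 1 := mem_ball_zero_iff.1 z.2
    rw [div_one, norm_const_mul_pow (hx0 n), ← hx, mul_comm, mul_comm (ψ _)]
    exact ψ.map_mul_le (by positivity) (pow_le_one₀ (norm_nonneg _) hz.le) (hx0 n)
  have hmod : ∀ n : ℕ, modular ψ α (fun z => (x n : ℂ) * (z : ℂ) ^ n) 1 ≤
      ENNReal.ofReal ((n : ℝ) ^ β / K) *
        ∫⁻ z : Disc, ENNReal.ofReal (‖(z : ℂ)‖ ^ n) ∂(weightedMeasure α) := fun n => by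
    rw [← lintegral_const_mul' _ _ ENNReal.ofReal_ne_top]
    refine lintegral_mono fun z => ?_
    rw [← ENNReal.ofReal_mul (by positivity)]
    exact ENNReal.ofReal_le_ofReal (hle n z)
  have hfin : ∀ n : ℕ, modular ψ α (fun z => (x n : ℂ) * (z : ℂ) ^ n) 1 < ∞ := fun n => by
    refine (hmod n).trans_lt (ENNReal.mul_lt_top ENNReal.ofReal_lt_top ?_)
    refine lt_of_le_of_lt (lintegral_mono (g := fun _ => 1) fun z => ?_) ?_
    · have hz : ‖(z : ℂ)‖ < 1 := mem_ball_zero_iff.1 z.2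
      exact ENNReal.ofReal_le_one.2 (pow_le_one₀ (norm_nonneg _) hz.le)
    · rw [lintegral_one, weightedMeasure_univ hα]; exact ENNReal.one_lt_top
  refine ⟨K, β, hK, hβ, hβ1, x,
    fun n => ⟨fun z => (x n : ℂ) * (z : ℂ) ^ n, IsHolo.const_mul_pow _ _, 1, one_pos, hfin n⟩,
    hx0, hx, fun n z => rfl, fun n hn => BergmanOrlicz.norm_le one_pos ?_⟩
  refine (hmod n).trans ((mul_le_mul_right (hKβ n hn) _).trans (le_of_eq ?_))
  have hn' : (0 : ℝ) < n := by exact_mod_cast hn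
  rw [← ENNReal.ofReal_mul (by positivity), Real.rpow_neg hn'.le, ← ENNReal.ofReal_one]
  congr 1
  field_simp

/-- Since `x ≤ ψ x` for large `x`, the coefficients grow at most linearly in `n`, and `t^n` wins. -/
theorem tendsto_monomial_coeff_mul_pow (ψ : OrliczFunction) {K β : ℝ} (hK : 0 < K) (hβ1 : β ≤ 1)
    {x : ℕ → ℝ} (hx0 : ∀ n, 0 ≤ x n) (hx : ∀ n, ψ (x n) = (n : ℝ) ^ β / K) {t : ℝ} (ht : 0 ≤ t)
    (ht1 : t < 1) : Tendsto (fun n => x n * t ^ n) atTop (𝓝 0) := by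
  obtain ⟨A, hA⟩ := eventually_atTop.1 ψ.eventually_le_self
  have h1 : Tendsto (fun n : ℕ => |A| * t ^ n + K⁻¹ * (n * t ^ n)) atTop (𝓝 0) := by
    simpa using ((tendsto_pow_atTop_nhds_zero_of_lt_one ht ht1).const_mul |A|).add
      ((tendsto_self_mul_const_pow_of_lt_one ht ht1).const_mul K⁻¹)
  refine squeeze_zero' (Eventually.of_forall fun n => mul_nonneg (hx0 n) (by positivity)) ?_ h1
  filter_upwards [eventually_ge_atTop 1] with n hn
  have hn' : (1 : ℝ) ≤ n := by exact_mod_cast hn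
  have h2 : (n : ℝ) ^ β / K ≤ K⁻¹ * n := by
    rw [div_eq_inv_mul]
    gcongr
    calc (n : ℝ) ^ β ≤ (n : ℝ) ^ (1 : ℝ) := Real.rpow_le_rpow_of_exponent_le hn' hβ1
      _ = n := Real.rpow_one _
  have h3 : 0 ≤ K⁻¹ * n := by positivity
  have h4 : x n ≤ |A| + K⁻¹ * n := by
    rcases le_total A (x n) with h | h
    · have := hA _ h
      rw [hx] at this
      linarith [abs_nonneg A]
    · linarith [le_abs_self A]
  calc x n * t ^ n ≤ (|A| + K⁻¹ * n) * t ^ n := by gcongr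
    _ = _ := by ring

/-! ### The main theorem -/

theorem proposition3p10 (α : ℝ) (hα : -1 < α) (b : ℝ) (hb : 1 < b) (ψ : OrliczFunction)
    (hψ : ψ.DeltaSup2) :
    ∃ ζ : ℂ, ‖ζ‖ = 1 ∧ ∃ φ : Disc → Disc, IsHolo (fun z => (φ z : ℂ)) ∧
      Set.range φ ⊆ approachRegion ζ b ∧
      ∃ T : BergmanOrlicz ψ hα →L[ℂ] BergmanOrlicz ψ hα,
        (∀ (f : BergmanOrlicz ψ hα) (z : Disc), T f z = f (φ z)) ∧ ¬ IsCompactOperator T := by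
  have h0 : 0 < α + 1 := by linarith
  have hb0 : 0 < b := by linarith
  obtain ⟨a, ε, φ, ha, hε, hε2, haP, hφ, hrange, hnorm⟩ := exists_lens_map hb (2 + |α|) h0
  have hq : ∀ z : Disc, 2 / b * (ε * (1 / 2) ^ a) * (1 - ‖(z : ℂ)‖ ^ 2) ^ a
      ≤ 1 - ‖(φ z : ℂ)‖ ^ 2 := fun z => by
    have hz : ‖(z : ℂ)‖ < 1 := mem_ball_zero_iff.1 z.2
    have hz0 := z.one_sub_sq_pos
    have h1 : ‖1 - (φ z : ℂ)‖ < b / 2 * (1 - ‖(φ z : ℂ)‖ ^ 2) := by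
      simpa [approachRegion] using hrange ⟨z, rfl⟩
    have h2 : 1 / 2 * (1 - ‖(z : ℂ)‖ ^ 2) ≤ ‖1 - (z : ℂ)‖ := by
      have := norm_sub_norm_le 1 (z : ℂ)
      rw [norm_one] at this
      nlinarith [sq_nonneg (1 - ‖(z : ℂ)‖)]
    calc 2 / b * (ε * (1 / 2) ^ a) * (1 - ‖(z : ℂ)‖ ^ 2) ^ a
        = 2 / b * (ε * (1 / 2 * (1 - ‖(z : ℂ)‖ ^ 2)) ^ a) := by
          rw [Real.mul_rpow (by norm_num) hz0.le]; ring
      _ ≤ 2 / b * (ε * ‖1 - (z : ℂ)‖ ^ a) := by gcongr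
      _ ≤ 2 / b * (b / 2 * (1 - ‖(φ z : ℂ)‖ ^ 2)) := by
          rw [← hnorm]; gcongr
      _ = _ := by field_simp
  obtain ⟨M, hM, hbdd⟩ := exists_modular_comp_le ψ hα (by positivity) haP hq
  obtain ⟨T, hT⟩ := exists_compositionOperator ψ hα hφ hM hbdd
  refine ⟨1, norm_one, φ, hφ, hrange, T, hT, ?_⟩
  obtain ⟨K, β, hK, hβ, hβ1, x, f, hx0, hx, hf, hf1⟩ := exists_normalized_monomials ψ hα
  obtain ⟨C, hC1, x₀, hx₀, hC⟩ := hψ.iterate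
  have hC0 : 0 < C := by linarith
  set P := 2 + |α| with hP
  -- Enough iterations of `Δ²` for `n^(β 2^j)` to beat the mass `n^(-P/a)` of the region near `1`.
  obtain ⟨j, hj⟩ : ∃ j : ℕ, P / a < β * 2 ^ j := by
    obtain ⟨j, hj⟩ := pow_unbounded_of_one_lt (P / a / β) one_lt_two
    exact ⟨j, (div_lt_iff₀' hβ).1 hj⟩
  have hcast : Tendsto (fun n : ℕ => (n : ℝ)) atTop atTop := tendsto_natCast_atTop_atTop
  refine BergmanOrlicz.not_isCompactOperator (f := f) (δ := 1 / (2 * C ^ j))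
    (by filter_upwards [eventually_gt_atTop 0] with n hn using hf1 n hn) (fun z => ?_)
    (by positivity) ?_
  · rw [tendsto_zero_iff_norm_tendsto_zero]
    simp only [hT, hf, norm_const_mul_pow (hx0 _)]
    exact tendsto_monomial_coeff_mul_pow ψ hK hβ1 hx0 hx (norm_nonneg _)
      (mem_ball_zero_iff.1 (φ z).2)
  have hX : ∀ᶠ n : ℕ in atTop, ψ x₀ < (n : ℝ) ^ β / K :=
    ((((tendsto_rpow_atTop hβ).comp hcast).atTop_div_const hK).eventually_gt_atTop _)
  have hgrow : ∀ᶠ n : ℕ in atTop,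
      1 < (α + 1) * (1 / 4) ^ P / K ^ 2 ^ j * (n : ℝ) ^ (β * 2 ^ j - P / a) :=
    (((tendsto_rpow_atTop (sub_pos.2 hj)).comp hcast).const_mul_atTop
      (by positivity)).eventually_gt_atTop 1
  filter_upwards [hX, hgrow, eventually_ge_atTop 1] with n hXn hgn hn
  have hn1 : (1 : ℝ) ≤ n := by exact_mod_cast hn
  have hn0 : (0 : ℝ) < n := by linarith
  have hxn : x₀ ≤ x n := ψ.le_of_map_lt (hx0 n) (by rwa [hx])
  refine BergmanOrlicz.le_norm_of_one_lt_modular ?_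
  -- Chosen so that `ρ^a = 1/n`; with `ε ≤ 1/2` this puts `φ z` within `1/(2n)` of `1`.
  set ρ : ℝ := (n : ℝ) ^ (-(1 / a)) with hρ
  have hρ0 : 0 < ρ := by positivity
  have hρ1 : ρ ≤ 1 :=
    Real.rpow_le_one_of_one_le_of_nonpos hn1 (neg_nonpos.2 (by positivity))
  have hρa : ρ ^ a = (n : ℝ)⁻¹ := by
    rw [hρ, ← Real.rpow_mul hn0.le, ← Real.rpow_neg_one]
    congr 1
    field_simp
  have hnear : ∀ z : Disc, ‖1 - (z : ℂ)‖ < ρ → ENNReal.ofReal (ψ (C ^ j * x n)) ≤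
      ENNReal.ofReal (ψ (‖T (f n) z‖ / (1 / (2 * C ^ j)))) := fun z hz => by
    refine ENNReal.ofReal_le_ofReal (ψ.mono (mul_nonneg (by positivity) (hx0 n)) ?_)
    have h1 : ‖1 - (φ z : ℂ)‖ ≤ 1 / 2 * (n : ℝ)⁻¹ := by
      rw [hnorm, ← hρa]; gcongr
    have h2 : 1 + -(1 / 2 * (n : ℝ)⁻¹) ≤ ‖(φ z : ℂ)‖ := by
      have := norm_sub_norm_le 1 (φ z : ℂ)
      rw [norm_one] at this
      linarith
    have hinv : (n : ℝ)⁻¹ ≤ 1 := inv_le_one_of_one_le₀ hn1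
    -- Bernoulli's inequality: `(1 - 1/(2n))^n ≥ 1/2`.
    have h3 : 1 / 2 ≤ ‖(φ z : ℂ)‖ ^ n := by
      calc (1 / 2 : ℝ) = 1 + n * -(1 / 2 * (n : ℝ)⁻¹) := by field_simp; norm_num
        _ ≤ (1 + -(1 / 2 * (n : ℝ)⁻¹)) ^ n := one_add_mul_le_pow (by linarith) n
        _ ≤ _ := pow_le_pow_left₀ (by linarith) h2 n
    rw [hT, hf, norm_const_mul_pow (hx0 n), div_div_eq_mul_div, div_one]
    have h4 : 0 ≤ x n * C ^ j := mul_nonneg (hx0 n) (by positivity)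
    nlinarith [mul_le_mul_of_nonneg_left h3 h4]
  refine lt_of_lt_of_le ?_ (mul_le_lintegral_near_one hα hρ0 hρ1 hnear)
  rw [← ENNReal.ofReal_mul (by positivity), ENNReal.one_lt_ofReal]
  refine hgn.trans_le ?_
  calc (α + 1) * (1 / 4) ^ P / K ^ 2 ^ j * (n : ℝ) ^ (β * 2 ^ j - P / a)
      = (α + 1) * (ρ / 4) ^ P * ψ (x n) ^ 2 ^ j := by
        have e1 : (ρ / 4) ^ P = (1 / 4) ^ P * (n : ℝ) ^ (-(P / a)) := by
          rw [div_eq_inv_mul, Real.mul_rpow (by norm_num) hρ0.le, hρ, ← Real.rpow_mul hn0.le,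
            one_div]
          congr 2 <;> ring
        have e2 : ψ (x n) ^ 2 ^ j = (n : ℝ) ^ (β * 2 ^ j) / K ^ 2 ^ j := by
          rw [hx, div_pow, ← Real.rpow_mul_natCast hn0.le]
          push_cast; rfl
        rw [e1, e2, sub_eq_add_neg, Real.rpow_add hn0]
        ring
    _ ≤ _ := by
        gcongr
        exact hC j (x n) hxn
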